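/- Let $\mathbb{F}_q$ be a finite field with $q$ elements, let $e>d\ge 0$ be integers, and let $g\in\mathbb{F}_q[T]$ be a polynomial of degree $e$. For a monic $f\in\mathbb{F}_q[T]$ of degree $d$, let $(r_1,\dots,r_k)$ be the sequence of successive nonzero remainders in the Euclidean algorithm applied to $(g,f)$: $$g=q_1f+r_1,\quad f=q_2r_1+r_2,\quad r_1=q_3r_2+r_3,\ \dots,\quad r_{k-2}=q_kr_{k-1}+r_k,\quad r_{k-1}=q_{k+1}r_k,$$ where $\deg r_1<\deg f$ and $\deg r_{i+1}<\deg r_i$ (the sequence is empty if $f$ divides $g$). Call $f$ *generic* with respect to $g$ if this sequence has length $d$, and let $\mathcal{G}$ be the set of monic polynomials of degree $d$ in $\mathbb{F}_q[T]$ which are generic with respect to $g$. Then: 1. if $f\in\mathcal{G}$, its remainder sequence $(r_1,\dots,r_d)$ satisfies $\deg r_k=d-k$ for $1\le k\le d$; 2. $$|\mathcal{G}|\ \ge\ q^d\left(1-\frac{d(2e-d+1)}{2q}\right);$$ 3. in particular, if $q>d(2e-d+1)/2$, then $\mathcal{G}$ is nonempty. -/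

import Mathlib

open Polynomial

open scoped Classical in
/-- The remainder sequence `(r₁, r₂, …, r_k)` of the Euclidean algorithm applied to `(a, b)`,
i.e. the list of the successive nonzero remainders:
`a = b * q₁ + r₁`, `b = r₁ * q₂ + r₂`, …, `r_{k-2} = r_{k-1} * q_k + r_k`, `r_{k-1} = r_k * q_{k+1}`.
It is empty when `b ∣ a` (and, by convention, when `b = 0`). -/
noncomputable def remainderSeq {F : Type*} [Field F] (a b : F[X]) : List F[X] :=
  if hb : b = 0 then []
  else if a % b = 0 then []
  else (a % b) :: remainderSeq b (a % b)
termination_by b.degree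
decreasing_by exact EuclideanDomain.mod_lt a hb

/-- The monic polynomials `f` of degree `d` that are generic with respect to `g`: the remainder
sequence of the Euclidean algorithm applied to `(g, f)` has length `d`. -/
def genericPolys {F : Type*} [Field F] (g : F[X]) (d : ℕ) : Set F[X] :=
  {f | f.Monic ∧ f.natDegree = d ∧ (remainderSeq g f).length = d}

/-!
Let `e = natDegree g`. For `j < d` consider the linear map `Φ_j(f)` sending `u` with `deg u < e - j`
to the coefficients of index `j, …, e - 1` of `u * f mod g`. It is linear in `f`, its source and target
both have dimension `e - j`, and its determinant is, up to a nonzero constant, the `j`-th subresultant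
of `(g, f)`. If all `Φ_j(f)` with `j < natDegree f` are injective, then no degree is
skipped in the Euclidean algorithm for `(g, f)`, so `f` is generic
(`length_remainderSeq_of_isRegularAt`).

To count the `f` for which `Φ_j(f)` fails to be injective, restrict to lines `f + t * h`: as soon as
`Φ_j(h)` is injective, the exceptional `t` are the opposites of eigenvalues of `Φ_j(h)⁻¹ Φ_j(f)`, so
there are at most `e - j` of them (`card_not_injective_add_smul_le`). A direction `h` that works for
all `j < d` simultaneously is any monic polynomial of degree `d - 1` for which `Φ_j(h)` is injective
for `j < d - 1`, the case `j = d - 1` being automatic. Such an `h` exists by induction on `d`, since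
the bound for `d - 1` is better than the bound for `d`. Averaging over all lines in the direction
`h` shows that `Φ_j` is not injective for at most `(e - j) * q ^ (d - 1)` monic polynomials of degree
`d`, and `∑_{j < d} (e - j) = d * (2 * e - d + 1) / 2`.
-/

/-! ### The remainder sequence -/

lemma natDegree_div_eq_sub {F : Type*} [Field F] (a : F[X]) {b : F[X]} (hb : b ≠ 0) :
    (a / b).natDegree = a.natDegree - b.natDegree := by
  rw [div_def, natDegree_C_mul (inv_ne_zero (leadingCoeff_ne_zero.2 hb)),
    natDegree_divByMonic _ (monic_mul_leadingCoeff_inv hb),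
    natDegree_mul_C (inv_ne_zero (leadingCoeff_ne_zero.2 hb))]

lemma remainderSeq_of_mod_ne_zero {F : Type*} [Field F] {a b : F[X]} (hb : b ≠ 0)
    (hr : a % b ≠ 0) : remainderSeq a b = (a % b) :: remainderSeq b (a % b) := by
  rw [remainderSeq, dif_neg hb, if_neg hr]

lemma remainderSeq_of_mod_eq_zero {F : Type*} [Field F] {a b : F[X]}
    (hr : a % b = 0) : remainderSeq a b = [] := by
  rw [remainderSeq]
  split_ifs <;> rfl

lemma natDegree_mod_lt_of_ne_zero {F : Type*} [Field F] {a b : F[X]} (hb : b ≠ 0)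
    (hr : a % b ≠ 0) : (a % b).natDegree < b.natDegree :=
  natDegree_lt_natDegree hr (EuclideanDomain.mod_lt a hb)

lemma length_remainderSeq_le {F : Type*} [Field F] (a b : F[X]) :
    (remainderSeq a b).length ≤ b.natDegree := by
  induction hn : b.natDegree using Nat.strong_induction_on generalizing a b with
  | _ n ih =>
    by_cases hb : b = 0
    · rw [remainderSeq, dif_pos hb]; simp
    by_cases hr : a % b = 0
    · rw [remainderSeq_of_mod_eq_zero hr]; simp
    · have hlt := natDegree_mod_lt_of_ne_zero hb hr
      have := ih _ (hn ▸ hlt) b (a % b) rfl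
      rw [remainderSeq_of_mod_ne_zero hb hr, List.length_cons]
      omega

/-- The degrees of the remainders decrease strictly, so a remainder sequence of the maximal possible
length takes every degree below that of the divisor. -/
lemma degree_getElem_remainderSeq {F : Type*} [Field F] (a b : F[X])
    (h : (remainderSeq a b).length = b.natDegree) (k : ℕ) (hk : k < (remainderSeq a b).length) :
    ((remainderSeq a b)[k]).degree = ((b.natDegree - (k + 1) : ℕ) : WithBot ℕ) := by
  induction k generalizing a b with
  | zero =>
    by_cases hb : b = 0
    · exact absurd (hk.trans_eq (h.trans (by rw [hb, natDegree_zero]))) (Nat.not_lt_zero _)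
    by_cases hr : a % b = 0
    · simp [remainderSeq_of_mod_eq_zero hr] at hk
    have hlt := natDegree_mod_lt_of_ne_zero hb hr
    have hle := length_remainderSeq_le b (a % b)
    simp only [remainderSeq_of_mod_ne_zero hb hr, List.length_cons, List.getElem_cons_zero] at h ⊢
    rw [degree_eq_natDegree hr]
    congr 1
    omega
  | succ k ih =>
    by_cases hb : b = 0
    · exact absurd (hk.trans_eq (h.trans (by rw [hb, natDegree_zero]))) (Nat.not_lt_zero _)
    by_cases hr : a % b = 0
    · simp [remainderSeq_of_mod_eq_zero hr] at hk
    have hlt := natDegree_mod_lt_of_ne_zero hb hr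
    have hle := length_remainderSeq_le b (a % b)
    simp only [remainderSeq_of_mod_ne_zero hb hr, List.length_cons, List.getElem_cons_succ]
      at h hk ⊢
    rw [ih b (a % b) (by omega) (by omega)]
    congr 1
    omega

/-! ### Regularity -/

/-- Nonvanishing of the `j`-th subresultant of `(g, f)`, expressed through the kernel of the
corresponding linear map: no nonzero `u` with `deg u < deg g - j` has `deg (u * f mod g) < j`. -/
def IsRegularAt {F : Type*} [Field F] (g f : F[X]) (j : ℕ) : Prop :=
  ∀ u : F[X], u.degree < ((g.natDegree - j : ℕ) : WithBot ℕ) →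
    ((u * f) % g).degree < (j : WithBot ℕ) → u = 0

lemma IsRegularAt.eq_zero_of_degree_add_lt {F : Type*} [Field F] {g f : F[X]} {j : ℕ}
    (h : IsRegularAt g f j) (hj : j ≤ g.natDegree) (hg : g ≠ 0) {u v : F[X]}
    (hu : u.degree < ((g.natDegree - j : ℕ) : WithBot ℕ))
    (huv : (u * f + v * g).degree < (j : WithBot ℕ)) : u = 0 := by
  refine h u hu ?_
  have h1 : (u * f) % g = (u * f + v * g) % g := mod_eq_of_dvd_sub ⟨-v, by ring⟩
  have h2 : (u * f + v * g) % g = u * f + v * g := by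
    rw [mod_eq_self_iff hg, degree_eq_natDegree hg]
    exact huv.trans_le (by exact_mod_cast hj)
  rwa [h1, h2]

/-- Regularity is inherited by the next pair of the Euclidean algorithm: a relation between `b` and
`a % b` rewrites as a relation between `a` and `b`. -/
lemma IsRegularAt.mod {F : Type*} [Field F] {a b : F[X]} {j : ℕ} (h : IsRegularAt a b j)
    (hb : b ≠ 0) (hab : b.natDegree < a.natDegree) (hj : j < b.natDegree) :
    IsRegularAt b (a % b) j := by
  have ha : a ≠ 0 := by rintro rfl; simp at hab
  intro u hu hlt
  by_contra hu0
  have hdiv : a % b = a - b * (a / b) := by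
    rw [eq_sub_iff_add_eq, add_comm, EuclideanDomain.div_add_mod]
  set v := (u * (a % b)) / b with hv
  -- The remainder of `u * (a % b)` modulo `b` as a combination of `b` and `a`; the cofactor of `b`
  -- must vanish by regularity of `(a, b)`, leaving a multiple of `a` of degree less than `j`.
  have hmod : (u * (a % b)) % b = (-v - u * (a / b)) * b + u * a := by
    have := EuclideanDomain.div_add_mod (u * (a % b)) b
    rw [← hv] at this
    linear_combination this + u * hdiv
  have hun : u.natDegree < b.natDegree - j := by
    rw [degree_eq_natDegree hu0] at hu
    exact_mod_cast hu
  have hvn : v.natDegree ≤ u.natDegree := by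
    have h1 : v.natDegree = (u * (a % b)).natDegree - b.natDegree := natDegree_div_eq_sub _ hb
    have h2 : (u * (a % b)).natDegree ≤ u.natDegree + (a % b).natDegree := natDegree_mul_le
    by_cases hr : a % b = 0
    · simp [hv, hr]
    · have := natDegree_mod_lt_of_ne_zero hb hr
      omega
  have hq : (a / b).natDegree = a.natDegree - b.natDegree := natDegree_div_eq_sub _ hb
  have hw : (-v - u * (a / b)).degree < ((a.natDegree - j : ℕ) : WithBot ℕ) := by
    refine (degree_le_natDegree).trans_lt ?_
    have h1 := natDegree_sub_le (-v) (u * (a / b))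
    have h2 : (u * (a / b)).natDegree ≤ u.natDegree + (a / b).natDegree := natDegree_mul_le
    rw [natDegree_neg] at h1
    have h3 : (-v - u * (a / b)).natDegree < a.natDegree - j := by omega
    exact_mod_cast h3
  rw [hmod] at hlt
  have h0 := h.eq_zero_of_degree_add_lt (by omega) ha hw hlt
  rw [h0, zero_mul, zero_add, degree_mul, degree_eq_natDegree hu0, degree_eq_natDegree ha] at hlt
  have : u.natDegree + a.natDegree < j := by exact_mod_cast hlt
  omega

lemma IsRegularAt.natDegree_mod {F : Type*} [Field F] {a b : F[X]} (hb : 0 < b.natDegree)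
    (h : IsRegularAt a b (b.natDegree - 1)) (hab : b.natDegree < a.natDegree) :
    a % b ≠ 0 ∧ (a % b).natDegree = b.natDegree - 1 := by
  have ha : a ≠ 0 := by rintro rfl; simp at hab
  have hb0 : b ≠ 0 := by rintro rfl; simp at hb
  have hq : (a / b).natDegree = a.natDegree - b.natDegree := natDegree_div_eq_sub _ hb0
  -- Otherwise `a % b = -(a / b) * b + a` would force `a / b = 0`.
  have hge : ¬ (a % b).degree < ((b.natDegree - 1 : ℕ) : WithBot ℕ) := by
    intro hlt
    have hsum : -(a / b) * b + 1 * a = a % b := by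
      linear_combination -EuclideanDomain.div_add_mod a b
    have h0 : -(a / b) = 0 := by
      refine h.eq_zero_of_degree_add_lt (v := 1) (by omega) ha ?_ (by rwa [hsum])
      rw [degree_neg]
      refine (degree_le_natDegree).trans_lt ?_
      have : (a / b).natDegree < a.natDegree - (b.natDegree - 1) := by omega
      exact_mod_cast this
    rw [neg_eq_zero] at h0
    simp [h0] at hq
    omega
  have hr : a % b ≠ 0 := by
    intro hr
    exact hge (by simp [hr])
  have := natDegree_mod_lt_of_ne_zero hb0 hr
  rw [degree_eq_natDegree hr, not_lt] at hge
  have : b.natDegree - 1 ≤ (a % b).natDegree := by exact_mod_cast hge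
  exact ⟨hr, by omega⟩

/-- If no subresultant vanishes, no degree is skipped in the Euclidean algorithm. -/
lemma length_remainderSeq_of_isRegularAt {F : Type*} [Field F] {a b : F[X]}
    (hab : b.natDegree < a.natDegree) (h : ∀ j < b.natDegree, IsRegularAt a b j) :
    (remainderSeq a b).length = b.natDegree := by
  induction hn : b.natDegree generalizing a b with
  | zero =>
    have := length_remainderSeq_le a b
    omega
  | succ n ih =>
    have hb0 : b ≠ 0 := by rintro rfl; simp at hn
    obtain ⟨hr, hdeg⟩ := (h (b.natDegree - 1) (by omega)).natDegree_mod (by omega) hab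
    rw [remainderSeq_of_mod_ne_zero hb0 hr, List.length_cons,
      ih (by omega) (fun j hj => (h j (by omega)).mod hb0 hab (by omega)) (by omega)]

/-- The highest index is automatic: below degree `deg g` no reduction takes place. -/
lemma isRegularAt_natDegree {F : Type*} [Field F] {g f : F[X]} (hf : f ≠ 0)
    (hfg : f.natDegree < g.natDegree) : IsRegularAt g f f.natDegree := by
  have hg : g ≠ 0 := by rintro rfl; simp at hfg
  intro u hu hlt
  by_contra hu0
  rw [degree_eq_natDegree hu0] at hu
  have hu' : u.natDegree < g.natDegree - f.natDegree := by exact_mod_cast hu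
  have hm : (u * f) % g = u * f := by
    rw [mod_eq_self_iff hg, degree_mul, degree_eq_natDegree hu0, degree_eq_natDegree hf,
      degree_eq_natDegree hg]
    exact_mod_cast (by omega : u.natDegree + f.natDegree < g.natDegree)
  rw [hm, degree_mul, degree_eq_natDegree hu0, degree_eq_natDegree hf] at hlt
  have : u.natDegree + f.natDegree < f.natDegree := by exact_mod_cast hlt
  omega

/-! ### Linear maps on a line -/

/-- On a line of linear maps in an injective direction, at most `dim U` members are not injective:
their parameters are the opposites of the eigenvalues of `B⁻¹ ∘ A`. -/
lemma card_not_injective_add_smul_le {F U W : Type*} [Field F] [Fintype F] [AddCommGroup U]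
    [Module F U] [AddCommGroup W] [Module F W] [FiniteDimensional F U] [FiniteDimensional F W]
    (hUW : Module.finrank F U = Module.finrank F W) (A B : U →ₗ[F] W)
    (hB : Function.Injective B) (s : Finset F)
    (hs : ∀ t ∈ s, ¬ Function.Injective (A + t • B)) : s.card ≤ Module.finrank F U := by
  classical
  let E := B.linearEquivOfInjective hB hUW
  let C : Module.End F U := E.symm.toLinearMap ∘ₗ A
  have hsub : s.image (fun t => -t) ⊆ C.charpoly.roots.toFinset := by
    intro μ hμ
    obtain ⟨t, ht, rfl⟩ := Finset.mem_image.1 hμ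
    have h1 := hs t ht
    rw [← LinearMap.ker_eq_bot, LinearMap.ker_eq_bot'] at h1
    push Not at h1
    obtain ⟨u, hu, hu0⟩ := h1
    rw [Multiset.mem_toFinset, mem_roots C.charpoly_monic.ne_zero,
      ← Module.End.hasEigenvalue_iff_isRoot_charpoly]
    refine Module.End.hasEigenvalue_of_hasEigenvector (x := u) ⟨?_, hu0⟩
    rw [Module.End.mem_eigenspace_iff]
    have hA : A u = E (-t • u) := by
      rw [LinearMap.linearEquivOfInjective_apply, map_smul, neg_smul]
      exact eq_neg_of_add_eq_zero_left (by simpa using hu)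
    change E.symm (A u) = _
    rw [hA, E.symm_apply_apply]
  calc s.card = (s.image (fun t => -t)).card :=
        (Finset.card_image_of_injective _ neg_injective).symm
    _ ≤ C.charpoly.roots.toFinset.card := Finset.card_le_card hsub
    _ ≤ Multiset.card C.charpoly.roots := Multiset.toFinset_card_le _
    _ ≤ C.charpoly.natDegree := card_roots' _
    _ = Module.finrank F U := C.charpoly_natDegree

/-- The linear map `u ↦ u * f mod g`, `deg u < deg g - j`, followed by the coefficients of index
`j, …, deg g - 1`. Reduction is taken modulo the monic polynomial associated with `g`, which is how
`%` is defined on `F[X]`. -/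
noncomputable def subresultantMap {F : Type*} [Field F] (g : F[X]) (j : ℕ) (f : F[X]) :
    degreeLT F (g.natDegree - j) →ₗ[F] (Fin (g.natDegree - j) → F) :=
  LinearMap.pi (fun i => lcoeff F (i + j)) ∘ₗ modByMonicHom (g * C g.leadingCoeff⁻¹) ∘ₗ
    LinearMap.mulRight F f ∘ₗ (degreeLT F (g.natDegree - j)).subtype

lemma subresultantMap_apply {F : Type*} [Field F] (g : F[X]) (j : ℕ) (f : F[X])
    (u : degreeLT F (g.natDegree - j)) (i : Fin (g.natDegree - j)) :
    subresultantMap g j f u i = (((u : F[X]) * f) % g).coeff (i + j) := rfl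

lemma subresultantMap_add_smul {F : Type*} [Field F] (g : F[X]) (j : ℕ) (f h : F[X]) (t : F) :
    subresultantMap g j (f + t • h) = subresultantMap g j f + t • subresultantMap g j h := by
  ext u i
  simp [subresultantMap, mul_add, add_modByMonic, smul_modByMonic]

lemma injective_subresultantMap_iff {F : Type*} [Field F] {g : F[X]} (hg : g ≠ 0) (j : ℕ)
    (f : F[X]) : Function.Injective (subresultantMap g j f) ↔ IsRegularAt g f j := by
  rw [← LinearMap.ker_eq_bot, LinearMap.ker_eq_bot']
  have key : ∀ u : degreeLT F (g.natDegree - j),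
      subresultantMap g j f u = 0 ↔ (((u : F[X]) * f) % g).degree < (j : WithBot ℕ) := by
    intro u
    rw [degree_lt_iff_coeff_zero]
    constructor
    · intro h m hm
      by_cases hmg : m < g.natDegree
      · have := congrFun h ⟨m - j, by omega⟩
        rw [subresultantMap_apply] at this
        simpa [Nat.sub_add_cancel hm] using this
      · refine coeff_eq_zero_of_degree_lt ((EuclideanDomain.mod_lt _ hg).trans_le ?_)
        rw [degree_eq_natDegree hg]
        exact_mod_cast not_lt.1 hmg
    · intro h
      ext i
      rw [subresultantMap_apply]
      exact h _ (by omega)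
  constructor
  · intro h u hu hlt
    exact congrArg Subtype.val (h ⟨u, mem_degreeLT.2 hu⟩ ((key _).2 hlt))
  · intro h u hu
    exact Subtype.ext (h u (mem_degreeLT.1 u.2) ((key u).1 hu))

/-! ### Counting -/

lemma degree_X_pow_add_of_degree_lt {F : Type*} [Field F] {d : ℕ} {p : F[X]} (hp : p.degree < d) :
    (X ^ d + p).degree = (d : WithBot ℕ) := by
  rw [degree_add_eq_left_of_degree_lt (by rwa [degree_X_pow]), degree_X_pow]

/-- A subset of a vector space that meets every line in the direction `h` in at most `n` points
has density at most `n / |F|`: average over the translates by multiples of `h`. -/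
lemma card_mul_card_le_of_lines {F V : Type*} [Field F] [Fintype F] [AddCommGroup V] [Module F V]
    [Fintype V] (P : V → Prop) [DecidablePred P] (h : V) (n : ℕ)
    (hP : ∀ v, (Finset.univ.filter fun t : F => P (v + t • h)).card ≤ n) :
    Fintype.card F * (Finset.univ.filter P).card ≤ n * Fintype.card V := by
  have h1 : ∀ t : F, (Finset.univ.filter fun v : V => P (v + t • h)).card
      = (Finset.univ.filter P).card := fun t =>
    Finset.card_equiv (Equiv.addRight (t • h)) (by simp)
  calc Fintype.card F * (Finset.univ.filter P).card
      = ∑ t : F, (Finset.univ.filter fun v : V => P (v + t • h)).card := by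
        simp [h1]
    _ = ∑ v : V, (Finset.univ.filter fun t : F => P (v + t • h)).card := by
        simp only [Finset.card_filter]
        exact Finset.sum_comm
    _ ≤ ∑ _v : V, n := Finset.sum_le_sum fun v _ => hP v
    _ = n * Fintype.card V := by simp [mul_comm]

noncomputable instance {F : Type*} [Field F] [Fintype F] (d : ℕ) : Fintype (degreeLT F d) :=
  Fintype.ofEquiv (Fin d → F) (degreeLTEquiv F d).symm.toEquiv

lemma card_degreeLT {F : Type*} [Field F] [Fintype F] (d : ℕ) :
    Fintype.card (degreeLT F d) = Fintype.card F ^ d := by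
  rw [Fintype.card_congr (degreeLTEquiv F d).toEquiv]
  simp

/-- The polynomial `X ^ d + v` is regular at every index below `d`. The elements `v` of
`degreeLT F d` parametrize the monic polynomials of degree `d`. -/
def IsRegularTail {F : Type*} [Field F] (g : F[X]) (d : ℕ) (v : degreeLT F d) : Prop :=
  ∀ j < d, IsRegularAt g (X ^ d + (v : F[X])) j

open scoped Classical in
/-- The exceptional monic polynomials of degree `d + 1` are counted along lines whose direction is a
regular monic polynomial of degree `d`. -/
lemma card_not_isRegularTail_le {F : Type*} [Field F] [Fintype F] {g : F[X]} {d : ℕ}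
    (hd : d < g.natDegree) (w : degreeLT F d) (hw : IsRegularTail g d w) :
    Fintype.card F * (Finset.univ.filter fun v => ¬ IsRegularTail g (d + 1) v).card
      ≤ (∑ j ∈ Finset.range (d + 1), (g.natDegree - j)) * Fintype.card F ^ (d + 1) := by
  have hg : g ≠ 0 := by rintro rfl; simp at hd
  have hwd : (w : F[X]).degree < d := mem_degreeLT.1 w.2
  set h : F[X] := X ^ d + (w : F[X]) with hh
  have hmonic : h.Monic := monic_X_pow_add hwd
  have hdeg : h.natDegree = d := natDegree_eq_of_degree_eq_some (degree_X_pow_add_of_degree_lt hwd)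
  have hreg : ∀ j < d + 1, IsRegularAt g h j := by
    intro j hj
    rcases Nat.lt_succ_iff_lt_or_eq.1 hj with hj | rfl
    · exact hw j hj
    · have := isRegularAt_natDegree hmonic.ne_zero (g := g) (by omega)
      rwa [hdeg] at this
  have hmem : h ∈ degreeLT F (d + 1) := by
    rw [mem_degreeLT, degree_X_pow_add_of_degree_lt hwd]
    exact_mod_cast Nat.lt_succ_self d
  have hj : ∀ j ∈ Finset.range (d + 1), Fintype.card F *
      (Finset.univ.filter fun v : degreeLT F (d + 1) =>
        ¬ IsRegularAt g (X ^ (d + 1) + (v : F[X])) j).card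
      ≤ (g.natDegree - j) * Fintype.card F ^ (d + 1) := by
    intro j hj
    rw [← card_degreeLT]
    refine card_mul_card_le_of_lines _ (⟨h, hmem⟩ : degreeLT F (d + 1)) _ fun v => ?_
    have hfin : Module.finrank F (degreeLT F (g.natDegree - j)) = g.natDegree - j := by
      rw [(degreeLTEquiv F _).finrank_eq]; simp
    have hfd : FiniteDimensional F (degreeLT F (g.natDegree - j)) :=
      (degreeLTEquiv F _).symm.finiteDimensional
    refine (card_not_injective_add_smul_le (by simp [hfin])
      (subresultantMap g j (X ^ (d + 1) + (v : F[X]))) (subresultantMap g j h)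
      ((injective_subresultantMap_iff hg j h).2 (hreg j (Finset.mem_range.1 hj))) _
      fun t ht => ?_).trans hfin.le
    rw [← subresultantMap_add_smul, injective_subresultantMap_iff hg]
    simpa [add_assoc] using (Finset.mem_filter.1 ht).2
  calc Fintype.card F * (Finset.univ.filter fun v => ¬ IsRegularTail g (d + 1) v).card
      ≤ Fintype.card F * ∑ j ∈ Finset.range (d + 1),
        (Finset.univ.filter fun v : degreeLT F (d + 1) =>
          ¬ IsRegularAt g (X ^ (d + 1) + (v : F[X])) j).card := by
        refine Nat.mul_le_mul_left _ ((Finset.card_le_card ?_).trans Finset.card_biUnion_le)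
        intro v hv
        simp only [IsRegularTail, Finset.mem_filter, Finset.mem_univ, true_and, not_forall,
          exists_prop] at hv
        simpa using hv
    _ ≤ _ := by
        rw [Finset.mul_sum, Finset.sum_mul]
        exact Finset.sum_le_sum hj

open scoped Classical in
/-- A large field carries a regular monic polynomial of degree `d`, and for it the count of the
exceptional ones is valid; the two claims are proved by a simultaneous induction. -/
lemma exists_isRegularTail_and_card_le {F : Type*} [Field F] [Fintype F] {g : F[X]} {d : ℕ}
    (hd : d < g.natDegree)
    (hq : ∑ j ∈ Finset.range d, (g.natDegree - j) < Fintype.card F) :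
    (∃ v, IsRegularTail g d v) ∧
    Fintype.card F * (Finset.univ.filter fun v => ¬ IsRegularTail g d v).card
      ≤ (∑ j ∈ Finset.range d, (g.natDegree - j)) * Fintype.card F ^ d := by
  induction d with
  | zero => exact ⟨⟨0, by simp [IsRegularTail]⟩, by simp [IsRegularTail]⟩
  | succ d ih =>
    obtain ⟨⟨w, hw⟩, -⟩ := ih (by omega) (by rw [Finset.sum_range_succ] at hq; omega)
    have hcard := card_not_isRegularTail_le (by omega) w hw
    refine ⟨?_, hcard⟩
    -- If all `q ^ (d + 1)` polynomials were exceptional, `q` would be at most the sum.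
    by_contra! hno
    rw [Finset.filter_true_of_mem fun v _ => hno v, Finset.card_univ, card_degreeLT] at hcard
    exact absurd (Nat.le_of_mul_le_mul_right hcard (pow_pos Fintype.card_pos _)) (by omega)

open scoped Classical in
lemma card_isRegularTail_le_ncard {F : Type*} [Field F] [Fintype F] {g : F[X]} {d : ℕ}
    (hd : d < g.natDegree) :
    (Finset.univ.filter fun v => IsRegularTail g d v).card ≤ (genericPolys g d).ncard := by
  have hdeg : ∀ v : degreeLT F d, (v : F[X]).degree < d := fun v => mem_degreeLT.1 v.2
  have hfin : (genericPolys g d).Finite := by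
    refine (Set.finite_range fun v : degreeLT F d => X ^ d + (v : F[X])).subset ?_
    rintro f ⟨hm, hf, -⟩
    refine ⟨⟨f - X ^ d, ?_⟩, by simp⟩
    rw [mem_degreeLT]
    have hfd : f.degree = d := by rw [degree_eq_natDegree hm.ne_zero, hf]
    rw [← hfd]
    exact degree_sub_lt_left (by rw [hfd, degree_X_pow]) hm.ne_zero (by simp [hm.leadingCoeff])
  rw [← Set.ncard_coe_finset]
  refine Set.ncard_le_ncard_of_injOn (fun v => X ^ d + (v : F[X])) (fun v hv => ?_) ?_ hfin
  · have hv : IsRegularTail g d v := by simpa using hv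
    have hn : (X ^ d + (v : F[X])).natDegree = d :=
      natDegree_eq_of_degree_eq_some (degree_X_pow_add_of_degree_lt (hdeg v))
    refine ⟨monic_X_pow_add (hdeg v), hn, ?_⟩
    rw [length_remainderSeq_of_isRegularAt (by omega) (by rwa [hn]), hn]
  · intro v _ w _ hvw
    exact Subtype.ext (add_left_cancel hvw)

/-- The degrees of the subresultants in the coefficients of `f` add up to the constant of the bound. -/
lemma cast_sum_range_sub {e d : ℕ} (hde : d ≤ e) :
    ((∑ j ∈ Finset.range d, (e - j) : ℕ) : ℝ) = (d : ℝ) * (2 * (e : ℝ) - (d : ℝ) + 1) / 2 := by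
  induction d with
  | zero => simp
  | succ d ih =>
    rw [Finset.sum_range_succ, Nat.cast_add, ih (by omega), Nat.cast_sub (by omega)]
    push_cast
    ring

theorem mainTheorem2 {F : Type*} [Field F] [Fintype F] (e d : ℕ) (hde : d < e)
    (g : F[X]) (hg : g.natDegree = e) :
    (∀ f ∈ genericPolys g d, ∀ (k : ℕ) (hk : k < (remainderSeq g f).length),
      ((remainderSeq g f)[k]).degree = ((d - (k + 1) : ℕ) : WithBot ℕ)) ∧
    ((genericPolys g d).ncard : ℝ) ≥
      (Fintype.card F : ℝ) ^ d *
        (1 - (d : ℝ) * (2 * (e : ℝ) - (d : ℝ) + 1) / (2 * (Fintype.card F : ℝ))) ∧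
    ((Fintype.card F : ℝ) > (d : ℝ) * (2 * (e : ℝ) - (d : ℝ) + 1) / 2 →
      (genericPolys g d).Nonempty) := by
  classical
  subst hg
  have hq0 : (0 : ℝ) < Fintype.card F := by exact_mod_cast Fintype.card_pos
  have hbound : ((genericPolys g d).ncard : ℝ) ≥ (Fintype.card F : ℝ) ^ d *
      (1 - (d : ℝ) * (2 * (g.natDegree : ℝ) - (d : ℝ) + 1) / (2 * (Fintype.card F : ℝ))) := by
    rw [mul_comm (2 : ℝ) (Fintype.card F : ℝ), ← div_div, div_right_comm,
      ← cast_sum_range_sub hde.le]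
    set S := ∑ j ∈ Finset.range d, (g.natDegree - j) with hS
    rcases le_or_gt (Fintype.card F) S with hSq | hSq
    · -- The bound is not positive in this case.
      have h1 : (1 : ℝ) ≤ (S : ℝ) / Fintype.card F := by
        rw [le_div_iff₀ hq0, one_mul]; exact_mod_cast hSq
      exact (mul_nonpos_of_nonneg_of_nonpos (by positivity) (by linarith)).trans
        (Nat.cast_nonneg _)
    · have hbad := (exists_isRegularTail_and_card_le hde hSq).2
      have hgood := card_isRegularTail_le_ncard (F := F) hde
      have htot := Finset.card_filter_add_card_filter_not (s := Finset.univ)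
        (fun v : degreeLT F d => IsRegularTail g d v)
      rw [Finset.card_univ, card_degreeLT] at htot
      rw [← hS] at hbad
      set bad := (Finset.univ.filter fun v : degreeLT F d => ¬ IsRegularTail g d v).card
      have hbad' : (bad : ℝ) ≤ S * (Fintype.card F : ℝ) ^ d / Fintype.card F := by
        rw [le_div_iff₀ hq0, mul_comm]; exact_mod_cast hbad
      have hge : (Fintype.card F : ℝ) ^ d ≤ (genericPolys g d).ncard + bad := by
        exact_mod_cast (by omega : Fintype.card F ^ d ≤ (genericPolys g d).ncard + bad)
      have : (Fintype.card F : ℝ) ^ d * (1 - S / Fintype.card F)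
          = (Fintype.card F : ℝ) ^ d - S * (Fintype.card F : ℝ) ^ d / Fintype.card F := by ring
      linarith
  refine ⟨?_, hbound, fun hq => ?_⟩
  · rintro f ⟨-, hf, hlen⟩ k hk
    rw [degree_getElem_remainderSeq g f (by omega) k hk, hf]
  · refine Set.nonempty_of_ncard_ne_zero fun h0 => ?_
    rw [h0, Nat.cast_zero] at hbound
    refine absurd hbound (not_le.2 (mul_pos (by positivity) ?_))
    rw [sub_pos, div_lt_one (by positivity)]
    linarith
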